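/- Let $m \ge 1$ and $r \ge 3$ be integers, put $n = m + r$, and let $0 < t_1 < t_2 < \cdots < t_n$ be integers. Let $A$ be the $m \times n$ integer matrix whose $j$-th column is $(1, t_j, t_j^2, \ldots, t_j^{m-1})^{T}$. Let $I_A \subset \mathbb{C}[x_1,\ldots,x_n]$ be the toric ideal of $A$, that is, the ideal generated by all binomials $x^u - x^v$ with $u, v \in \mathbb{N}^n$ and $Au = Av$, and let $\mathcal{L}_A = \{v \in \mathbb{Z}^n : Av = 0\}$. For a maximal $\mathbb{Q}$-linearly independent subset $B$ of $\mathcal{L}_A$, let $J_B$ be the ideal generated by the binomials $x^{v^+} - x^{v^-}$, $v \in B$, where $v = v^+ - v^-$ is the decomposition of $v$ into its positive and negative parts; the ideals $J_B$ are called basis ideals of $A$. A proper ideal is called a complete intersection if it can be generated by as many elements as its height. If $n \ge 2(r^2 - r + 1)$, then $I_A$ does not contain any complete intersection basis ideal. -/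

import Mathlib

open MvPolynomial

/-- The toric ideal `I_A` in `ℂ[x_1, …, x_n]` of an integer `m × n` matrix `A`: it is generated by
all binomials `x^u - x^v` with `u, v ∈ ℕ^n` and `A u = A v`. -/
noncomputable def toricIdeal {m n : ℕ} (A : Matrix (Fin m) (Fin n) ℤ) :
    Ideal (MvPolynomial (Fin n) ℂ) :=
  Ideal.span {f | ∃ u v : Fin n →₀ ℕ,
    A.mulVec (fun i => (u i : ℤ)) = A.mulVec (fun i => (v i : ℤ)) ∧
    f = monomial u (1 : ℂ) - monomial v (1 : ℂ)}

/-- The lattice `L_A = {v ∈ ℤ^n : A v = 0}`. -/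
def kernelLattice {m n : ℕ} (A : Matrix (Fin m) (Fin n) ℤ) : Submodule ℤ (Fin n → ℤ) :=
  LinearMap.ker A.mulVecLin

/-- The positive part `v⁺ ∈ ℕ^n` of an integer vector, as an exponent vector. -/
noncomputable def posExponent {n : ℕ} (v : Fin n → ℤ) : Fin n →₀ ℕ :=
  Finsupp.equivFunOnFinite.symm (fun i => (v i).toNat)

/-- The binomial `x^{v⁺} - x^{v⁻}` of an integer vector `v = v⁺ - v⁻`. -/
noncomputable def latticeBinomial {n : ℕ} (v : Fin n → ℤ) : MvPolynomial (Fin n) ℂ :=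
  monomial (posExponent v) (1 : ℂ) - monomial (posExponent (-v)) (1 : ℂ)

/-- `B` is a maximal set of vectors of `L_A` that are linearly independent over `ℚ`. -/
def IsMaximalIndependent {m n : ℕ} (A : Matrix (Fin m) (Fin n) ℤ) (B : Set (Fin n → ℤ)) : Prop :=
  Maximal (fun S : Set (Fin n → ℤ) => S ⊆ (kernelLattice A : Set (Fin n → ℤ)) ∧
    LinearIndepOn ℚ (fun (v : Fin n → ℤ) (i : Fin n) => (v i : ℚ)) S) B

/-- The ideal `J_B` generated by the binomials `x^{v⁺} - x^{v⁻}`, `v ∈ B`. -/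
noncomputable def binomialIdeal {n : ℕ} (B : Set (Fin n → ℤ)) : Ideal (MvPolynomial (Fin n) ℂ) :=
  Ideal.span (latticeBinomial '' B)

/-- `J` is a basis ideal of `A`: it is `J_B` for a maximal linearly independent `B ⊆ L_A`. -/
def IsBasisIdeal {m n : ℕ} (A : Matrix (Fin m) (Fin n) ℤ)
    (J : Ideal (MvPolynomial (Fin n) ℂ)) : Prop :=
  ∃ B : Set (Fin n → ℤ), IsMaximalIndependent A B ∧ J = binomialIdeal B

/-- An ideal is a complete intersection if it can be generated by as many elements as its height
(codimension). The unit ideal, which has infinite height, is not one. -/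
def IsCompleteIntersection {R : Type*} [CommRing R] (I : Ideal R) : Prop :=
  ∃ s : Finset R, Ideal.span (s : Set R) = I ∧ I.height = (s.card : ℕ∞)

/-- The matrix whose `j`-th column is `(1, t_j, t_j^2, …, t_j^{m-1})`: the vertices of a cyclic
polytope on the moment curve, in homogeneous coordinates. -/
def cyclicMatrix (m : ℕ) {n : ℕ} (t : Fin n → ℤ) : Matrix (Fin m) (Fin n) ℤ :=
  Matrix.of fun i j => t j ^ (i : ℕ)

/-! A nonzero kernel vector is orthogonal to all polynomials of degree `< m` at the increasing nodes
`t_j`, so it changes sign at least `m` times. Among `n = m + r` coordinates this leaves at most `2(r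
- 1)` adjacent pairs without opposite signs. A basis has `r` vectors and `n - 1 > 2r(r - 1)`, so
some adjacent pair `a, b` has opposite signs in every basis vector
(`exists_common_adjacent_sign_change`). Each binomial then lies in `(x_a, x_b)`, so `J_B` has height
at most 2. But gradients at `(1, …, 1)` show that `J_B` needs at least `r ≥ 3` generators
(`card_le_card_of_span_eq_binomialIdeal`). -/

/-! ### Sign changes and orthogonality to polynomials -/

/-- The signs of a sequence, where a zero entry repeats the sign before it. -/
def extendedSign (w : ℕ → ℚ) (s : SignType) : ℕ → SignType
  | 0 => s
  | k + 1 => if w (k + 1) = 0 then extendedSign w s k else SignType.sign (w (k + 1))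

theorem extendedSign_ne_zero {w : ℕ → ℚ} {s : SignType} (hs : s ≠ 0) (k : ℕ) :
    extendedSign w s k ≠ 0 := by
  induction k with
  | zero => exact hs
  | succ k ih =>
    rw [extendedSign]
    split_ifs with h
    · exact ih
    · simpa [sign_eq_zero_iff] using h

theorem extendedSign_eq_of_forall_lt {w : ℕ → ℚ} {s : SignType} {k₀ : ℕ}
    (h0 : ∀ k < k₀, w k = 0) (hs : s = SignType.sign (w k₀)) (k : ℕ) (hk : k ≤ k₀) :
    extendedSign w s k = s := by
  induction k with
  | zero => rfl
  | succ k ih =>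
    rw [extendedSign]
    split_ifs with h
    · exact ih (by omega)
    · have : k + 1 = k₀ := by
        by_contra hne
        exact h (h0 _ (by omega))
      rw [this, hs]

theorem SignType.mul_self_eq_one {s : SignType} (hs : s ≠ 0) : s * s = 1 := by
  revert hs; revert s; decide

theorem SignType.mul_eq_neg_one {s u : SignType} (hs : s ≠ 0) (hu : u ≠ 0) (h : s ≠ u) :
    s * u = -1 := by
  revert hs hu h; revert s u; decide

/-- The polynomial that changes sign exactly where the extended signs of `w` do. -/
noncomputable def signPolynomial (n : ℕ) (σ : ℕ → SignType) (t : ℕ → ℚ) : Polynomial ℚ :=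
  ∏ j ∈ (Finset.range (n - 1)).filter (fun j => σ (j + 1) ≠ σ j),
    (Polynomial.C ((t j + t (j + 1)) / 2) - Polynomial.X)

theorem natDegree_signPolynomial_le (n : ℕ) (σ : ℕ → SignType) (t : ℕ → ℚ) :
    (signPolynomial n σ t).natDegree ≤
      ((Finset.range (n - 1)).filter (fun j => σ (j + 1) ≠ σ j)).card := by
  refine (Polynomial.natDegree_prod_le _ _).trans ?_
  refine (Finset.sum_le_card_nsmul _ _ 1 fun j _ => ?_).trans (by simp)
  refine (Polynomial.natDegree_sub_le _ _).trans ?_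
  simp

theorem prod_consecutive_signs {σ : ℕ → SignType} (hσ : ∀ k, σ k ≠ 0) (k : ℕ) :
    ∏ j ∈ Finset.range k, (σ (j + 1) * σ j) = σ k * σ 0 := by
  induction k with
  | zero => simp [SignType.mul_self_eq_one (hσ 0)]
  | succ k ih =>
    rw [Finset.prod_range_succ, ih]
    calc σ k * σ 0 * (σ (k + 1) * σ k) = (σ k * σ k) * (σ (k + 1) * σ 0) := by ac_rfl
      _ = _ := by rw [SignType.mul_self_eq_one (hσ k), one_mul]

/-- At `t k` the factors with `j < k` are negative and the others positive; the sign changes before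
`k` telescope to `σ k * σ 0`. -/
theorem sign_eval_signPolynomial {n : ℕ} {σ : ℕ → SignType} (hσ : ∀ k, σ k ≠ 0) {t : ℕ → ℚ}
    (ht : ∀ i j, i < j → j < n → t i < t j) {k : ℕ} (hk : k < n) :
    SignType.sign ((signPolynomial n σ t).eval (t k)) = σ k * σ 0 := by
  have hmono : ∀ i j, i ≤ j → j < n → t i ≤ t j := fun i j hij hj => by
    rcases hij.eq_or_lt with rfl | h
    · exact le_rfl
    · exact (ht i j h hj).le
  have hhom : ∀ x : ℚ, signHom x = SignType.sign x := fun _ => rfl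
  rw [← prod_consecutive_signs hσ, signPolynomial, Polynomial.eval_prod, Finset.prod_filter,
    ← hhom, map_prod]
  have hsplit : n - 1 = k + (n - 1 - k) := by omega
  rw [hsplit, Finset.prod_range_add, ← mul_one (∏ j ∈ Finset.range k, (σ (j + 1) * σ j))]
  congr 1
  · refine Finset.prod_congr rfl fun j hj => ?_
    have hj := Finset.mem_range.mp hj
    split_ifs with h
    · rw [SignType.mul_eq_neg_one (hσ _) (hσ _) h, hhom, sign_eq_neg_one_iff]
      have h1 := ht j (j + 1) (by omega) (by omega)
      have h2 := hmono (j + 1) k (by omega) hk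
      simp only [Polynomial.eval_sub, Polynomial.eval_C, Polynomial.eval_X]
      linarith
    · rw [not_not.mp h, SignType.mul_self_eq_one (hσ j), map_one]
  · refine Finset.prod_eq_one fun j hj => ?_
    have hj := Finset.mem_range.mp hj
    split_ifs with h
    · rw [hhom, sign_eq_one_iff]
      have h1 := ht (k + j) (k + j + 1) (by omega) (by omega)
      have h2 := hmono k (k + j) (by omega) (by omega)
      simp only [Polynomial.eval_sub, Polynomial.eval_C, Polynomial.eval_X]
      linarith
    · rw [map_one]

/-- Descartes' rule of signs for vectors orthogonal to the polynomials of degree `< m`. -/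
theorem card_sign_changes_ge {n m : ℕ} {σ : ℕ → SignType} (hσ : ∀ k, σ k ≠ 0) {t w : ℕ → ℚ}
    (ht : ∀ i j, i < j → j < n → t i < t j)
    (hw : ∀ p : Polynomial ℚ, p.natDegree < m → ∑ k ∈ Finset.range n, w k * p.eval (t k) = 0)
    (hne : ∃ k < n, w k ≠ 0) (hσw : ∀ k < n, w k ≠ 0 → σ k = SignType.sign (w k)) :
    m ≤ ((Finset.range (n - 1)).filter (fun j => σ (j + 1) ≠ σ j)).card := by
  by_contra hlt
  have h0 := hw (signPolynomial n σ t)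
    ((natDegree_signPolynomial_le n σ t).trans_lt (not_le.mp hlt))
  -- All nonzero terms of the vanishing sum have the same sign, which is absurd.
  have hsign : ∀ k < n, w k ≠ 0 →
      SignType.sign (w k * (signPolynomial n σ t).eval (t k)) = σ 0 := fun k hk hwk => by
    rw [sign_mul, sign_eval_signPolynomial hσ ht hk, ← hσw k hk hwk, ← mul_assoc,
      SignType.mul_self_eq_one (hσ k), one_mul]
  obtain ⟨k, hk, hwk⟩ := hne
  rcases SignType.trichotomy (σ 0) with h | h | h
  · refine absurd h0 (ne_of_lt (Finset.sum_neg' (fun i hi => ?_)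
      ⟨k, Finset.mem_range.mpr hk, sign_eq_neg_one_iff.mp ((hsign k hk hwk).trans h)⟩))
    by_cases hwi : w i = 0
    · simp [hwi]
    · exact (sign_eq_neg_one_iff.mp ((hsign i (Finset.mem_range.mp hi) hwi).trans h)).le
  · exact hσ 0 h
  · refine absurd h0 (ne_of_gt (Finset.sum_pos' (fun i hi => ?_)
      ⟨k, Finset.mem_range.mpr hk, sign_eq_one_iff.mp ((hsign k hk hwk).trans h)⟩))
    by_cases hwi : w i = 0
    · simp [hwi]
    · exact (sign_eq_one_iff.mp ((hsign i (Finset.mem_range.mp hi) hwi).trans h)).le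

/-- Each extended sign change from `j` to `j + 1` has `w (j + 1) ≠ 0`, and the first nonzero entry
precedes them all. Such a change is a strict one unless `w j = 0`. -/
theorem support_and_adjacent_sign_changes {n m : ℕ} {t w : ℕ → ℚ}
    (ht : ∀ i j, i < j → j < n → t i < t j)
    (hw : ∀ p : Polynomial ℚ, p.natDegree < m → ∑ k ∈ Finset.range n, w k * p.eval (t k) = 0)
    (hne : ∃ k < n, w k ≠ 0) :
    m + 1 ≤ ((Finset.range n).filter (fun k => w k ≠ 0)).card ∧
    m ≤ ((Finset.range (n - 1)).filter (fun j => w j * w (j + 1) < 0)).card +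
      ((Finset.range n).filter (fun k => w k = 0)).card := by
  classical
  have hne' : ∃ k, w k ≠ 0 := hne.imp fun k h => h.2
  set k₀ := Nat.find hne' with hk₀
  have hk₀w : w k₀ ≠ 0 := Nat.find_spec hne'
  have hbefore : ∀ k < k₀, w k = 0 := fun k hk => not_not.mp (Nat.find_min hne' hk)
  have hk₀n : k₀ < n := by
    obtain ⟨k, hk, hwk⟩ := hne
    exact (Nat.find_min' hne' hwk).trans_lt hk
  -- Leading zeros take the sign of the first nonzero entry, so they create no change.
  set s := SignType.sign (w k₀) with hs
  have hs0 : s ≠ 0 := by simpa [hs, sign_eq_zero_iff] using hk₀w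
  set σ := extendedSign w s with hσdef
  have hσ : ∀ k, σ k ≠ 0 := extendedSign_ne_zero hs0
  have hstep : ∀ k, w (k + 1) = 0 → σ (k + 1) = σ k := fun k hk => by
    rw [hσdef, extendedSign, if_pos hk]
  have hinit : ∀ k ≤ k₀, σ k = s := extendedSign_eq_of_forall_lt hbefore hs
  have hσw : ∀ k, w k ≠ 0 → σ k = SignType.sign (w k) := fun k hk => by
    cases k with
    | zero =>
      have : k₀ = 0 := Nat.le_zero.mp (Nat.find_min' hne' hk)
      rw [hinit 0 (Nat.zero_le _), hs, this]
    | succ k => rw [hσdef, extendedSign, if_neg hk]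
  have hC := card_sign_changes_ge hσ ht hw hne fun k _ => hσw k
  set C := (Finset.range (n - 1)).filter (fun j => σ (j + 1) ≠ σ j) with hCdef
  have hCmem : ∀ j ∈ C, j < n - 1 ∧ σ (j + 1) ≠ σ j := fun j hj => by simpa [hCdef] using hj
  constructor
  · have hsub : insert k₀ (C.image (· + 1)) ⊆ (Finset.range n).filter (fun k => w k ≠ 0) := by
      intro k hk
      rw [Finset.mem_insert, Finset.mem_image] at hk
      rw [Finset.mem_filter, Finset.mem_range]
      rcases hk with rfl | ⟨j, hj, rfl⟩
      · exact ⟨hk₀n, hk₀w⟩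
      · obtain ⟨h1, h2⟩ := hCmem j hj
        exact ⟨by omega, fun h => h2 (hstep j h)⟩
    have hnot : k₀ ∉ C.image (· + 1) := fun h => by
      obtain ⟨j, hj, hjk⟩ := Finset.mem_image.mp h
      exact (hCmem j hj).2 ((hinit _ hjk.le).trans (hinit j (by omega)).symm)
    have := Finset.card_le_card hsub
    rw [Finset.card_insert_of_notMem hnot,
      Finset.card_image_of_injective _ (add_left_injective 1)] at this
    omega
  · refine hC.trans (le_trans (Finset.card_le_card fun j hj => ?_) (Finset.card_union_le _ _))
    obtain ⟨h1, h2⟩ := hCmem j hj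
    rw [Finset.mem_union, Finset.mem_filter, Finset.mem_filter, Finset.mem_range, Finset.mem_range]
    by_cases h : w j = 0
    · exact Or.inr ⟨by omega, h⟩
    · left
      have h3 : w (j + 1) ≠ 0 := fun h => h2 (hstep j h)
      refine ⟨h1, ?_⟩
      rw [← sign_eq_neg_one_iff, sign_mul, ← hσw j h, ← hσw _ h3]
      exact SignType.mul_eq_neg_one (hσ _) (hσ _) h2.symm

/-! ### The rational kernel and its bases -/

/-- An integer vector as a rational one. -/
def ratVector {n : ℕ} (v : Fin n → ℤ) : Fin n → ℚ := fun i => v i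

/-- The rational kernel of the cyclic matrix. -/
def ratKernel (m : ℕ) {n : ℕ} (t : Fin n → ℤ) : Submodule ℚ (Fin n → ℚ) :=
  LinearMap.ker ((cyclicMatrix m t).map (Int.cast : ℤ → ℚ)).mulVecLin

theorem mem_ratKernel {m n : ℕ} {t : Fin n → ℤ} {q : Fin n → ℚ} :
    q ∈ ratKernel m t ↔ ∀ i < m, ∑ k, q k * (t k : ℚ) ^ i = 0 := by
  simp only [ratKernel, LinearMap.mem_ker, Matrix.mulVecLin_apply, funext_iff, Fin.forall_iff,
    Matrix.mulVec, dotProduct, Matrix.map_apply, cyclicMatrix, Matrix.of_apply, Int.cast_pow,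
    Pi.zero_apply, mul_comm]

theorem mem_kernelLattice {m n : ℕ} {t : Fin n → ℤ} {v : Fin n → ℤ} :
    v ∈ kernelLattice (cyclicMatrix m t) ↔ ratVector v ∈ ratKernel m t := by
  rw [mem_ratKernel]
  simp only [kernelLattice, LinearMap.mem_ker, Matrix.mulVecLin_apply, funext_iff, Fin.forall_iff,
    Matrix.mulVec, dotProduct, cyclicMatrix, Matrix.of_apply, Pi.zero_apply, ratVector]
  refine forall₂_congr fun i _ => ?_
  rw [← Int.cast_inj (α := ℚ)]
  push_cast
  simp only [mul_comm]

/-- The extension by zero of a function on `Fin n` to the natural numbers. -/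
def extendZero {n : ℕ} (q : Fin n → ℚ) (k : ℕ) : ℚ := if h : k < n then q ⟨k, h⟩ else 0

@[simp] theorem extendZero_coe {n : ℕ} (q : Fin n → ℚ) (k : Fin n) : extendZero q k = q k := by
  simp [extendZero]

theorem extendZero_of_lt {n : ℕ} (q : Fin n → ℚ) {k : ℕ} (hk : k < n) :
    extendZero q k = q ⟨k, hk⟩ := by
  simp [extendZero, hk]

theorem sum_mul_eval_eq_zero {m n : ℕ} {t : Fin n → ℤ} {q : Fin n → ℚ} (hq : q ∈ ratKernel m t)
    {p : Polynomial ℚ} (hp : p.natDegree < m) :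
    ∑ k ∈ Finset.range n, extendZero q k * p.eval (extendZero (fun i => (t i : ℚ)) k) = 0 := by
  rw [Finset.sum_range]
  simp only [extendZero_coe, Polynomial.eval_eq_sum_range, Finset.mul_sum]
  rw [Finset.sum_comm]
  refine Finset.sum_eq_zero fun i hi => ?_
  have hi := Finset.mem_range.mp hi
  have h := mem_ratKernel.mp hq i (by omega)
  calc ∑ k, q k * (p.coeff i * (t k : ℚ) ^ i) = p.coeff i * ∑ k, q k * (t k : ℚ) ^ i := by
        rw [Finset.mul_sum]
        exact Finset.sum_congr rfl fun k _ => by ring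
    _ = 0 := by rw [h, mul_zero]

theorem card_filter_ratKernel {m n : ℕ} {t : Fin n → ℤ} (ht : StrictMono t) {q : Fin n → ℚ}
    (hq : q ∈ ratKernel m t) (hq0 : q ≠ 0) :
    m + 1 ≤ ((Finset.range n).filter (fun k => extendZero q k ≠ 0)).card ∧
    m ≤ ((Finset.range (n - 1)).filter (fun j => extendZero q j * extendZero q (j + 1) < 0)).card +
      ((Finset.range n).filter (fun k => extendZero q k = 0)).card := by
  refine support_and_adjacent_sign_changes (t := extendZero fun i => (t i : ℚ)) ?_
    (fun p hp => sum_mul_eval_eq_zero hq hp) ?_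
  · intro i j hij hj
    rw [extendZero_of_lt _ hj, extendZero_of_lt _ (hij.trans hj)]
    exact Int.cast_lt.mpr (ht hij)
  · obtain ⟨k, hk⟩ := Function.ne_iff.mp hq0
    exact ⟨k, k.2, by simpa using hk⟩

/-- There are at most `r - 1` zeros, hence at least `m - (r - 1)` strict changes among `m + r - 1`
pairs. -/
theorem card_not_adjacent_sign_change_le {m r n : ℕ} (hn : n = m + r) {t : Fin n → ℤ}
    (ht : StrictMono t) {q : Fin n → ℚ} (hq : q ∈ ratKernel m t) (hq0 : q ≠ 0) :
    ((Finset.range (n - 1)).filter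
      (fun j => ¬ extendZero q j * extendZero q (j + 1) < 0)).card ≤ 2 * (r - 1) := by
  obtain ⟨h1, h2⟩ := card_filter_ratKernel ht hq hq0
  have h3 : ((Finset.range n).filter (fun k => extendZero q k = 0)).card +
      ((Finset.range n).filter (fun k => extendZero q k ≠ 0)).card = (Finset.range n).card :=
    Finset.card_filter_add_card_filter_not _
  have h4 := Finset.card_filter_add_card_filter_not (s := Finset.range (n - 1))
    (fun j => extendZero q j * extendZero q (j + 1) < 0)
  rw [Finset.card_range] at h3 h4
  omega

theorem finrank_ratKernel_le {m r n : ℕ} (hn : n = m + r) {t : Fin n → ℤ} (ht : StrictMono t) :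
    Module.finrank ℚ (ratKernel m t) ≤ r := by
  subst hn
  -- A kernel vector vanishing on the last `r` coordinates has support of size at most `m`, so it is
  -- zero.
  let π : (Fin (m + r) → ℚ) →ₗ[ℚ] (Fin r → ℚ) := LinearMap.funLeft ℚ ℚ (Fin.natAdd m)
  have hinj : Function.Injective (π ∘ₗ (ratKernel m t).subtype) := by
    rw [injective_iff_map_eq_zero]
    intro q hq
    by_contra hq0
    have hle := (card_filter_ratKernel ht q.2 fun h => hq0 (Subtype.ext h)).1
    have hsub : (Finset.range (m + r)).filter (fun k => extendZero (q : Fin (m + r) → ℚ) k ≠ 0) ⊆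
        Finset.range m := by
      intro k hk
      obtain ⟨hk, hne⟩ := Finset.mem_filter.mp hk
      have hk := Finset.mem_range.mp hk
      rw [Finset.mem_range]
      by_contra hmk
      apply hne
      rw [extendZero_of_lt _ hk]
      have := congrFun hq ⟨k - m, by omega⟩
      have hidx : Fin.natAdd m ⟨k - m, by omega⟩ = (⟨k, hk⟩ : Fin (m + r)) := by
        ext; simp; omega
      rw [← hidx]
      exact this
    have := Finset.card_le_card hsub
    rw [Finset.card_range] at this
    omega
  simpa using LinearMap.finrank_le_finrank_of_injective hinj

theorem le_finrank_ratKernel {m r n : ℕ} (hn : n = m + r) (t : Fin n → ℤ) :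
    r ≤ Module.finrank ℚ (ratKernel m t) := by
  let f := ((cyclicMatrix m t).map (Int.cast : ℤ → ℚ)).mulVecLin
  have h1 := LinearMap.finrank_range_add_finrank_ker f
  have h2 := Submodule.finrank_le (LinearMap.range f)
  rw [Module.finrank_fin_fun] at h1 h2
  have : Module.finrank ℚ (ratKernel m t) = Module.finrank ℚ (LinearMap.ker f) := rfl
  omega

theorem exists_smul_eq_ratVector {n : ℕ} (q : Fin n → ℚ) :
    ∃ (d : ℚ) (v : Fin n → ℤ), d ≠ 0 ∧ ratVector v = d • q := by
  obtain ⟨b, hb⟩ := IsLocalization.exist_integer_multiples_of_finite (nonZeroDivisors ℤ) q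
  choose v hv using hb
  refine ⟨(b : ℤ), v, by exact_mod_cast nonZeroDivisors.coe_ne_zero b, ?_⟩
  ext i
  have := hv i
  simpa [ratVector] using this

/-- A rational kernel vector outside the span, with denominators cleared, would enlarge `B`. -/
theorem IsMaximalIndependent.le_span {m n : ℕ} {t : Fin n → ℤ} {B : Set (Fin n → ℤ)}
    (hB : IsMaximalIndependent (cyclicMatrix m t) B) :
    ratKernel m t ≤ Submodule.span ℚ (ratVector '' B) := by
  intro q hq
  by_contra hqB
  obtain ⟨d, v, hd, hv⟩ := exists_smul_eq_ratVector q
  have hvB : ratVector v ∉ Submodule.span ℚ (ratVector '' B) := fun h => by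
    rw [hv, Submodule.smul_mem_iff _ hd] at h
    exact hqB h
  have hins : LinearIndepOn ℚ ratVector (insert v B) := hB.prop.2.insert hvB
  have hmem : v ∈ B := hB.le_of_ge
    ⟨Set.insert_subset (mem_kernelLattice.mpr (hv ▸ Submodule.smul_mem _ d hq)) hB.prop.1, hins⟩
    (Set.subset_insert v B) (Set.mem_insert v B)
  exact hvB (Submodule.subset_span (Set.mem_image_of_mem _ hmem))

theorem IsMaximalIndependent.span_eq {m n : ℕ} {t : Fin n → ℤ} {B : Set (Fin n → ℤ)}
    (hB : IsMaximalIndependent (cyclicMatrix m t) B) :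
    Submodule.span ℚ (ratVector '' B) = ratKernel m t := by
  refine le_antisymm (Submodule.span_le.mpr ?_) hB.le_span
  rintro _ ⟨v, hv, rfl⟩
  exact mem_kernelLattice.mp (hB.prop.1 hv)

theorem IsMaximalIndependent.linearIndependent {m n : ℕ} {A : Matrix (Fin m) (Fin n) ℤ}
    {B : Set (Fin n → ℤ)} (hB : IsMaximalIndependent A B) :
    LinearIndependent ℚ (fun v : B => ratVector (v : Fin n → ℤ)) := hB.prop.2

theorem IsMaximalIndependent.finite {m n : ℕ} {A : Matrix (Fin m) (Fin n) ℤ}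
    {B : Set (Fin n → ℤ)} (hB : IsMaximalIndependent A B) : B.Finite :=
  Set.finite_coe_iff.mp hB.linearIndependent.finite

theorem IsMaximalIndependent.card_eq {m r n : ℕ} (hn : n = m + r) {t : Fin n → ℤ}
    (ht : StrictMono t) {B : Finset (Fin n → ℤ)}
    (hB : IsMaximalIndependent (cyclicMatrix m t) (B : Set (Fin n → ℤ))) : B.card = r := by
  have h := finrank_span_eq_card hB.linearIndependent
  rw [show Set.range (fun v : (B : Set (Fin n → ℤ)) => ratVector (v : Fin n → ℤ)) =
    ratVector '' (B : Set (Fin n → ℤ)) from (Set.image_eq_range _ _).symm, hB.span_eq] at h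
  have h1 := finrank_ratKernel_le hn ht
  have h2 := le_finrank_ratKernel hn t
  have h3 : Fintype.card (B : Set (Fin n → ℤ)) = B.card := by simp
  omega

theorem exists_common_adjacent_sign_change {m r n : ℕ} (hn : n = m + r) (hr : 1 ≤ r)
    (hnr : 2 * (r ^ 2 - r + 1) ≤ n) {t : Fin n → ℤ} (ht : StrictMono t)
    {B : Finset (Fin n → ℤ)}
    (hB : IsMaximalIndependent (cyclicMatrix m t) (B : Set (Fin n → ℤ))) :
    ∃ a b : Fin n, ∀ v ∈ B, v a * v b < 0 := by
  set bad : (Fin n → ℤ) → Finset ℕ := fun v => (Finset.range (n - 1)).filter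
    (fun j => ¬ extendZero (ratVector v) j * extendZero (ratVector v) (j + 1) < 0) with hbad
  have hcard : (B.biUnion bad).card ≤ r * (2 * (r - 1)) := by
    rw [← hB.card_eq hn ht]
    refine Finset.card_biUnion_le_card_mul _ _ _ fun v hv => ?_
    rw [hB.card_eq hn ht]
    exact card_not_adjacent_sign_change_le hn ht
      (mem_kernelLattice.mp (hB.prop.1 hv)) (hB.linearIndependent.ne_zero ⟨v, hv⟩)
  have hlt : (B.biUnion bad).card < (Finset.range (n - 1)).card := by
    rw [Finset.card_range]
    obtain ⟨k, rfl⟩ : ∃ k, r = k + 1 := ⟨r - 1, by omega⟩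
    have h1 : (k + 1) ^ 2 - (k + 1) = (k + 1) * k := by
      rw [pow_two, ← Nat.mul_sub_one, Nat.add_sub_cancel]
    have h2 : (k + 1) * (2 * (k + 1 - 1)) = 2 * ((k + 1) * k) := by
      rw [Nat.add_sub_cancel]; ring
    omega
  obtain ⟨j, hj, hjB⟩ := Finset.exists_mem_notMem_of_card_lt_card hlt
  have hj' := Finset.mem_range.mp hj
  refine ⟨⟨j, by omega⟩, ⟨j + 1, by omega⟩, fun v hv => ?_⟩
  have hjv : j ∉ bad v := fun h => hjB (Finset.mem_biUnion.mpr ⟨v, hv, h⟩)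
  rw [hbad, Finset.mem_filter, not_and, not_not] at hjv
  have := hjv hj
  rw [extendZero_of_lt _ (show j < n by omega), extendZero_of_lt _ (show j + 1 < n by omega)]
    at this
  simp only [ratVector] at this
  exact_mod_cast this

/-! ### Height at most two -/

theorem posExponent_apply {n : ℕ} (v : Fin n → ℤ) (i : Fin n) : posExponent v i = (v i).toNat :=
  rfl

theorem monomial_posExponent_mem {n : ℕ} {I : Ideal (MvPolynomial (Fin n) ℂ)} {v : Fin n → ℤ}
    {i : Fin n} (hi : X i ∈ I) (hv : 0 < v i) : monomial (posExponent v) (1 : ℂ) ∈ I := by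
  refine I.mem_of_dvd ?_ hi
  rw [X_dvd_monomial]
  right
  rw [posExponent_apply]
  omega

theorem latticeBinomial_mem {n : ℕ} {I : Ideal (MvPolynomial (Fin n) ℂ)} {v : Fin n → ℤ}
    {a b : Fin n} (ha : X a ∈ I) (hb : X b ∈ I) (hv : v a * v b < 0) : latticeBinomial v ∈ I := by
  rcases mul_neg_iff.mp hv with ⟨h1, h2⟩ | ⟨h1, h2⟩
  · exact I.sub_mem (monomial_posExponent_mem ha h1)
      (monomial_posExponent_mem hb (by simpa using h2))
  · exact I.sub_mem (monomial_posExponent_mem hb h2)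
      (monomial_posExponent_mem ha (by simpa using h1))

theorem height_span_X_pair_le {n : ℕ} (a b : Fin n) :
    (Ideal.span {X a, X b} : Ideal (MvPolynomial (Fin n) ℂ)).height ≤ 2 := by
  have hne : (Ideal.span {X a, X b} : Ideal (MvPolynomial (Fin n) ℂ)) ≠ ⊤ := by
    intro h
    have hle : Ideal.span {X a, X b} ≤ RingHom.ker (eval (0 : Fin n → ℂ)) := by
      rw [Ideal.span_le]
      rintro p (rfl | rfl) <;> simp [RingHom.mem_ker]
    rw [h, top_le_iff] at hle
    exact RingHom.ker_ne_top _ hle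
  -- Krull's height theorem.
  refine (Ideal.height_le_spanRank_toENat _ hne).trans ?_
  have h1 := Submodule.spanRank_span_le_card (R := MvPolynomial (Fin n) ℂ)
    ({X a, X b} : Set (MvPolynomial (Fin n) ℂ))
  have h2 : Cardinal.mk ({X a, X b} : Set (MvPolynomial (Fin n) ℂ)) ≤ 2 := by
    refine (Cardinal.mk_insert_le).trans ?_
    rw [Cardinal.mk_singleton, one_add_one_eq_two]
  have := Cardinal.toENat_le_ofNat (c := Submodule.spanRank
    (Ideal.span {X a, X b} : Ideal (MvPolynomial (Fin n) ℂ))) (n := 2)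
  exact this.mpr (h1.trans h2)

/-! ### Lower bound on the number of generators -/

/-- The gradient of a polynomial at the point `(1, …, 1)`. -/
noncomputable def gradientAtOne (n : ℕ) : MvPolynomial (Fin n) ℂ →ₗ[ℂ] (Fin n → ℂ) :=
  LinearMap.pi fun i => (aeval (1 : Fin n → ℂ)).toLinearMap ∘ₗ (pderiv i).toLinearMap

theorem gradientAtOne_apply {n : ℕ} (p : MvPolynomial (Fin n) ℂ) (i : Fin n) :
    gradientAtOne n p i = eval 1 (pderiv i p) := by
  simp [gradientAtOne, aeval_eq_eval]

theorem gradientAtOne_mul {n : ℕ} (p q : MvPolynomial (Fin n) ℂ) (hq : eval 1 q = 0) :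
    gradientAtOne n (p * q) = eval 1 p • gradientAtOne n q := by
  ext i
  simp [gradientAtOne_apply, hq]

theorem gradientAtOne_latticeBinomial {n : ℕ} (v : Fin n → ℤ) (i : Fin n) :
    gradientAtOne n (latticeBinomial v) i = v i := by
  have h : ((v i).toNat : ℤ) - ((-v i).toNat : ℤ) = v i := by omega
  rw [gradientAtOne_apply, latticeBinomial, map_sub, pderiv_monomial, pderiv_monomial, map_sub]
  simp only [eval_monomial, Pi.one_apply, one_pow, Finsupp.prod_fun_one, posExponent_apply,
    Pi.neg_apply, one_mul, mul_one]
  exact_mod_cast congrArg (Int.cast : ℤ → ℂ) h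

theorem eval_one_latticeBinomial {n : ℕ} (v : Fin n → ℤ) :
    eval (1 : Fin n → ℂ) (latticeBinomial v) = 0 := by
  simp [latticeBinomial, eval_monomial]

theorem eval_one_eq_zero_of_mem_binomialIdeal {n : ℕ} {B : Set (Fin n → ℤ)}
    {p : MvPolynomial (Fin n) ℂ} (hp : p ∈ binomialIdeal B) : eval (1 : Fin n → ℂ) p = 0 := by
  have : binomialIdeal B ≤ RingHom.ker (eval (1 : Fin n → ℂ)) := by
    rw [binomialIdeal, Ideal.span_le]
    rintro _ ⟨v, -, rfl⟩
    exact eval_one_latticeBinomial v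
  exact this hp

/-- By the Leibniz rule, multiplying a generator that vanishes at `(1, …, 1)` only rescales its
gradient there. -/
theorem gradientAtOne_mem_span {n : ℕ} {s : Set (MvPolynomial (Fin n) ℂ)}
    (hs : ∀ p ∈ s, eval (1 : Fin n → ℂ) p = 0) {p : MvPolynomial (Fin n) ℂ}
    (hp : p ∈ Ideal.span s) : gradientAtOne n p ∈ Submodule.span ℂ (gradientAtOne n '' s) := by
  induction hp using Submodule.closure_induction with
  | zero => simp
  | add p q _ _ hp hq => rw [map_add]; exact Submodule.add_mem _ hp hq
  | smul_mem a p hp =>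
    rw [smul_eq_mul, gradientAtOne_mul a p (hs p hp)]
    exact Submodule.smul_mem _ _ (Submodule.subset_span (Set.mem_image_of_mem _ hp))

theorem linearIndependent_complex_of_rat {ι : Type*} {n : ℕ} {v : ι → Fin n → ℤ}
    (hv : LinearIndependent ℚ fun j => ratVector (v j)) :
    LinearIndependent ℂ fun j => (fun i => (v j i : ℂ) : Fin n → ℂ) := by
  rw [linearIndependent_iff'] at hv ⊢
  intro s c hc j hj
  -- `ℚ`-linear functionals on `ℂ` separate points and turn a complex relation between integer
  -- vectors into a rational one.
  rw [← Module.forall_dual_apply_eq_zero_iff ℚ]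
  intro f
  refine hv s (fun j => f (c j)) ?_ j hj
  ext i
  have h := congrArg f (congrFun hc i)
  simp only [Finset.sum_apply, Pi.smul_apply, smul_eq_mul, Pi.zero_apply, map_zero, map_sum] at h
  simp only [Finset.sum_apply, Pi.smul_apply, smul_eq_mul, Pi.zero_apply, ratVector]
  rw [← h]
  refine Finset.sum_congr rfl fun k _ => ?_
  rw [mul_comm (c k), ← zsmul_eq_mul, map_zsmul, zsmul_eq_mul, mul_comm]

theorem card_le_card_of_span_eq_binomialIdeal {n : ℕ} {B : Finset (Fin n → ℤ)}
    (hB : LinearIndependent ℚ fun v : (B : Set (Fin n → ℤ)) => ratVector (v : Fin n → ℤ))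
    {s : Finset (MvPolynomial (Fin n) ℂ)}
    (hs : Ideal.span (s : Set (MvPolynomial (Fin n) ℂ)) = binomialIdeal (B : Set (Fin n → ℤ))) :
    B.card ≤ s.card := by
  classical
  have hle : Submodule.span ℂ (Set.range fun v : (B : Set (Fin n → ℤ)) =>
      (fun i => ((v : Fin n → ℤ) i : ℂ))) ≤
      Submodule.span ℂ ((s.image (gradientAtOne n) : Finset (Fin n → ℂ)) : Set (Fin n → ℂ)) := by
    rw [Submodule.span_le]
    rintro _ ⟨v, rfl⟩
    have hv : latticeBinomial (v : Fin n → ℤ) ∈ Ideal.span (s : Set (MvPolynomial (Fin n) ℂ)) := by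
      rw [hs]
      exact Ideal.subset_span (Set.mem_image_of_mem _ v.2)
    have := gradientAtOne_mem_span (fun p hp => eval_one_eq_zero_of_mem_binomialIdeal
      (hs ▸ Ideal.subset_span hp)) hv
    rw [Finset.coe_image]
    rwa [show gradientAtOne n (latticeBinomial (v : Fin n → ℤ)) = _ from
      funext (gradientAtOne_latticeBinomial _)] at this
  have h1 := Submodule.finrank_mono hle
  rw [finrank_span_eq_card (linearIndependent_complex_of_rat hB)] at h1
  have h2 := finrank_span_finset_le_card (R := ℂ) (s.image (gradientAtOne n))
  have h3 : Fintype.card (B : Set (Fin n → ℤ)) = B.card := by simp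
  have h4 : (s.image (gradientAtOne n)).card ≤ s.card := Finset.card_image_le
  rw [← h3]
  exact h1.trans (h2.trans h4)

theorem theorem4p1 (m r n : ℕ) (hnmr : n = m + r) (hr : 3 ≤ r)
    (hn : 2 * (r ^ 2 - r + 1) ≤ n) (t : Fin n → ℤ) (htpos : ∀ i, 0 < t i) (ht : StrictMono t) :
    ¬ ∃ J : Ideal (MvPolynomial (Fin n) ℂ),
      IsBasisIdeal (cyclicMatrix m t) J ∧
      J ≤ toricIdeal (cyclicMatrix m t) ∧
      IsCompleteIntersection J := by
  rintro ⟨_, ⟨B, hB, rfl⟩, -, s, hs, hheight⟩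
  lift B to Finset (Fin n → ℤ) using hB.finite
  obtain ⟨a, b, hab⟩ := exists_common_adjacent_sign_change hnmr (by omega) hn ht hB
  have hle : binomialIdeal (B : Set (Fin n → ℤ)) ≤ Ideal.span {X a, X b} := by
    rw [binomialIdeal, Ideal.span_le]
    rintro _ ⟨v, hv, rfl⟩
    exact latticeBinomial_mem (Ideal.subset_span (by simp)) (Ideal.subset_span (by simp))
      (hab v hv)
  have h1 := (Ideal.height_mono hle).trans (height_span_X_pair_le a b)
  rw [hheight] at h1
  have h2 : s.card ≤ 2 := by exact_mod_cast h1
  have h3 := card_le_card_of_span_eq_binomialIdeal hB.linearIndependent hs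
  have h4 := hB.card_eq hnmr ht
  omega
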